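/- **Setting.** Let $L,K,M$ and $N_1,\dots,N_L$ be dimensions, $\mathbf H_i\in\mathbb C^{M\times N_i}$ channel matrices, $\mathbf\Sigma_s\in\mathbb C^{K\times K}$ the source covariance, $\mathbf\Sigma_i\succeq 0$ ($K\times K$, $i=1,\dots,L$) the covariances of the sensing noises, $\sigma_0^2>0$ the variance of the white receiver noise and $P_i>0$ the power budgets. For precoders $\mathbf F=\{\mathbf F_i\}_{i=1}^L$, $\mathbf F_i\in\mathbb C^{N_i\times K}$, put $$\widetilde{\mathbf H}_{\mathbf F}=\sum_{i=1}^L\mathbf H_i\mathbf F_i,\qquad \mathbf\Sigma_n(\mathbf F)=\sigma_0^2\mathbf I_M+\sum_{i=1}^L\mathbf H_i\mathbf F_i\mathbf\Sigma_i\mathbf F_i^H\mathbf H_i^H .$$ The mutual-information maximization problem is $$(\mathsf P0)\quad \max_{\mathbf F}\ \mathsf{MI}(\mathbf F)=\log\det\big(\mathbf I_M+\widetilde{\mathbf H}_{\mathbf F}\mathbf\Sigma_s\widetilde{\mathbf H}_{\mathbf F}^H\mathbf\Sigma_n(\mathbf F)^{-1}\big)\quad\text{s.t. } p_i(\mathbf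 F)=\mathsf{Tr}\{\mathbf F_i(\mathbf\Sigma_s+\mathbf\Sigma_i)\mathbf F_i^H\}\le P_i\ \ (i=1,\dots,L).$$ A point $\mathbf F$ is a KKT point of $(\mathsf P0)$ if it is feasible and there are $\lambda_i\ge 0$ with $\lambda_i(p_i(\mathbf F)-P_i)=0$ for all $i$ such that the derivative (with respect to the real and imaginary parts of all entries) of the Lagrangian $\mathsf{MI}-\sum_i\lambda_i(p_i-P_i)$ exists and vanishes at $\mathbf F$. For $\mathbf G\in\mathbb C^{M\times K}$ and $\mathbf W\in\mathbb C^{K\times K}$ let $$\mathbf E(\mathbf F,\mathbf G)=(\mathbf I-\mathbf G^H\widetilde{\mathbf H}_{\mathbf F})\mathbf\Sigma_s(\mathbf I-\mathbf G^H\widetilde{\mathbf H}_{\mathbf F})^H+\mathbf G^H\mathbf\Sigma_n(\mathbf F)\mathbf G,$$ $$\mathsf{MI}(\mathbf F,\mathbf W,\mathbf G)=\log\det\mathbf W-\mathsf{Tr}\{\mathbf W\mathbf E(\mathbf F,\mathbf G)\}+\log\det\mathbf\Sigma_s+K .$$ **Algorithm 1 (batch-mode BCA), run without stopping.** Choose any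 feasible $\mathbf F^{(0)}$; for every $j\ge0$ put $$\mathbf G^{(j)}=\big[\widetilde{\mathbf H}_{\mathbf F^{(j)}}\mathbf\Sigma_s\widetilde{\mathbf H}_{\mathbf F^{(j)}}^H+\mathbf\Sigma_n(\mathbf F^{(j)})\big]^{-1}\widetilde{\mathbf H}_{\mathbf F^{(j)}}\mathbf\Sigma_s,\qquad \mathbf W^{(j)}=\mathbf E(\mathbf F^{(j)},\mathbf G^{(j)})^{-1},$$ and let $\mathbf F^{(j+1)}$ be given by an arbitrary optimal solution $(\mathbf f,t,s)$, $\mathbf f=[vec(\mathbf F_1)^T,\dots,vec(\mathbf F_L)^T]^T$, of the following second-order cone program with $\mathbf W=\mathbf W^{(j)}$, $\mathbf G=\mathbf G^{(j)}$ (over complex $\mathbf f$ and real $t,s$): $$\min t\quad\text{s.t.}\quad s-2\,\mathsf{Re}\{vec(\mathbf G)^H\mathbf B\mathbf f\}+c\le t,\quad \left\|\begin{matrix}(\mathbf A+\mathbf C)^{1/2}\mathbf f\\ \frac{s-1}2\end{matrix}\right\|_2\le\frac{s+1}2,\quad \left\|\begin{matrix}\mathbf D_i^{1/2}\mathbf f\\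 \frac{P_i-1}2\end{matrix}\right\|_2\le\frac{P_i+1}2\ \ (i=1,\dots,L).$$ Here, with $^*$ denoting entrywise conjugation, $\mathbf A$ has blocks $\mathbf\Sigma_s^*\otimes(\mathbf H_i^H\mathbf G\mathbf W\mathbf G^H\mathbf H_j)$, $\mathbf B$ is the block row with blocks $(\mathbf W\mathbf\Sigma_s)^*\otimes\mathbf H_i$, $\mathbf C$ is block diagonal with blocks $\mathbf\Sigma_i^*\otimes(\mathbf H_i^H\mathbf G\mathbf W\mathbf G^H\mathbf H_i)$, $\mathbf D_i$ is block diagonal with $i$-th block $(\mathbf\Sigma_s+\mathbf\Sigma_i)^*\otimes\mathbf I_{N_i}$ and all other blocks zero, and $c=\mathsf{Tr}\{\mathbf W\mathbf\Sigma_s\}+\sigma_0^2\mathsf{Tr}\{\mathbf G\mathbf W\mathbf G^H\}$. **Theorem (Convergence).** Suppose $\mathbf\Sigma_s\succ0$. From every feasible $\mathbf F^{(0)}$ Algorithm 1 generates an infinite sequence of iterates, and for every sequence $(\mathbf F^{(j)},\mathbf W^{(j)},\mathbf G^{(j)})_{j\ge0}$ so generated: 1. the mutual-information sequences $\mathsf{MI}(\mathbf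 F^{(j)})$ and $\mathsf{MI}(\mathbf F^{(j)},\mathbf W^{(j)},\mathbf G^{(j)})$ are nondecreasing in $j$; 2. the sequence $(\mathbf F^{(j)},\mathbf W^{(j)},\mathbf G^{(j)})$ has a limit point (the limit of some subsequence); 3. for every limit point $(\bar{\mathbf F},\bar{\mathbf W},\bar{\mathbf G})$ of this sequence, and likewise for every limit point $\bar{\mathbf F}$ of the sequence $(\mathbf F^{(j)})$ alone, $\bar{\mathbf F}$ is a KKT point of $(\mathsf P0)$. -/

import Mathlib

open Matrix Filter Topology
open scoped Kronecker MatrixOrder ComplexOrder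

noncomputable section

/-- The data of a coherent multi-sensor network with `L` sensors, source dimension `K`, a fusion
center with `M` antennae, and `N i` antennae at sensor `i`. -/
structure SensorNetwork (L K M : ℕ) (N : Fin L → ℕ) where
  /-- channel matrix from sensor `i` to the fusion center -/
  H : (i : Fin L) → Matrix (Fin M) (Fin (N i)) ℂ
  /-- source covariance -/
  covS : Matrix (Fin K) (Fin K) ℂ
  /-- observation noise covariance at sensor `i` -/
  covN : Fin L → Matrix (Fin K) (Fin K) ℂ
  /-- standard deviation of the white receiver noise, whose covariance is `σ₀ ^ 2 • 1` -/
  σ₀ : ℝ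
  /-- power budget of sensor `i` -/
  P : Fin L → ℝ

/-- The precoder families `(F_i)_{i}`, with `F_i` of size `N i × K`. -/
abbrev Precoders (L K : ℕ) (N : Fin L → ℕ) : Type :=
  (i : Fin L) → Matrix (Fin (N i)) (Fin K) ℂ

/-- Index set of the stacked vector `f = [vec(F_1); …; vec(F_L)]`. -/
abbrev StackIdx (L K : ℕ) (N : Fin L → ℕ) : Type :=
  (i : Fin L) × (Fin K × Fin (N i))

/-- The stacked vector `f = [vec(F_1); …; vec(F_L)]` (column-wise vectorization). -/
def stackVec {L K : ℕ} {N : Fin L → ℕ} (F : Precoders L K N) : StackIdx L K N → ℂ :=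
  fun p => (F p.1).vec p.2

/-- `x` is the limit of some subsequence of `u`. -/
def IsLimitPoint {X : Type*} [TopologicalSpace X] (u : ℕ → X) (x : X) : Prop :=
  ∃ φ : ℕ → ℕ, StrictMono φ ∧ Tendsto (u ∘ φ) atTop (𝓝 x)

/-- The Euclidean norm of the vector obtained by appending the real number `r` to `v`. -/
def stackedNorm {ι : Type*} [Fintype ι] (v : ι → ℂ) (r : ℝ) : ℝ :=
  ‖(WithLp.toLp 2 (Sum.elim v (fun _ : Unit => (r : ℂ))) : EuclideanSpace ℂ (ι ⊕ Unit))‖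

namespace SensorNetwork

variable {L K M : ℕ} {N : Fin L → ℕ} (S : SensorNetwork L K M N)

/-- The overall channel `∑ i, H_i F_i`. -/
def effChannel (F : Precoders L K N) : Matrix (Fin M) (Fin K) ℂ :=
  ∑ i, S.H i * F i

/-- The covariance `σ₀² I + ∑ i, H_i F_i Σ_i F_iᴴ H_iᴴ` of the compound noise. -/
def noiseCov (F : Precoders L K N) : Matrix (Fin M) (Fin M) ℂ :=
  ((S.σ₀ : ℂ) ^ 2) • (1 : Matrix (Fin M) (Fin M) ℂ)
    + ∑ i, S.H i * F i * S.covN i * (F i)ᴴ * (S.H i)ᴴ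

/-- The mutual information between source and received signal,
`log det (I + H̃ Σ_s H̃ᴴ Σ_n⁻¹)`. -/
def mutualInfo (F : Precoders L K N) : ℝ :=
  Real.log (det (1 + S.effChannel F * S.covS * (S.effChannel F)ᴴ * (S.noiseCov F)⁻¹)).re

/-- The average transmit power `Tr (F_i (Σ_s + Σ_i) F_iᴴ)` of sensor `i`. -/
def power (F : Precoders L K N) (i : Fin L) : ℝ :=
  (trace (F i * (S.covS + S.covN i) * (F i)ᴴ)).re

/-- Feasibility for the per-sensor power constraints. -/
def IsFeasible (F : Precoders L K N) : Prop :=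
  ∀ i, S.power F i ≤ S.P i

/-- The Lagrangian of maximizing `mutualInfo` under the power constraints. -/
def lagrangian (mult : Fin L → ℝ) (F : Precoders L K N) : ℝ :=
  S.mutualInfo F - ∑ i, mult i * (S.power F i - S.P i)

/-- `F` satisfies the KKT conditions of the problem of maximizing `mutualInfo` under the power
constraints. Stationarity is with respect to the real and imaginary parts of the entries. -/
def IsKKTPoint (F : Precoders L K N) : Prop :=
  ∃ mult : Fin L → ℝ,
    HasFDerivAt (𝕜 := ℝ) (S.lagrangian mult) 0 F ∧
    S.IsFeasible F ∧
    (∀ i, 0 ≤ mult i) ∧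
    ∀ i, mult i * (S.power F i - S.P i) = 0

/-- The error covariance `(I - Gᴴ H̃) Σ_s (I - Gᴴ H̃)ᴴ + Gᴴ Σ_n G` of the postcoder `G`. -/
def mseMatrix (F : Precoders L K N) (G : Matrix (Fin M) (Fin K) ℂ) :
    Matrix (Fin K) (Fin K) ℂ :=
  (1 - Gᴴ * S.effChannel F) * S.covS * (1 - Gᴴ * S.effChannel F)ᴴ + Gᴴ * S.noiseCov F * G

/-- The augmented objective
`log det W - Tr (W E(F, G)) + log det Σ_s + K`, with `E` the error covariance. -/
def augmentedInfo (F : Precoders L K N) (W : Matrix (Fin K) (Fin K) ℂ)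
    (G : Matrix (Fin M) (Fin K) ℂ) : ℝ :=
  Real.log (det W).re - (trace (W * S.mseMatrix F G)).re + Real.log (det S.covS).re + K

/-- The postcoder update `[H̃ Σ_s H̃ᴴ + Σ_n]⁻¹ H̃ Σ_s`. -/
def updateG (F : Precoders L K N) : Matrix (Fin M) (Fin K) ℂ :=
  (S.effChannel F * S.covS * (S.effChannel F)ᴴ + S.noiseCov F)⁻¹ * S.effChannel F * S.covS

/-- The weight update: the inverse of the error covariance. -/
def updateW (F : Precoders L K N) (G : Matrix (Fin M) (Fin K) ℂ) : Matrix (Fin K) (Fin K) ℂ :=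
  (S.mseMatrix F G)⁻¹

/-- The block matrix with blocks `A_{ij} = Σ_s^* ⊗ (H_iᴴ G W Gᴴ H_j)`. -/
def matA (W : Matrix (Fin K) (Fin K) ℂ) (G : Matrix (Fin M) (Fin K) ℂ) :
    Matrix (StackIdx L K N) (StackIdx L K N) ℂ :=
  Matrix.of fun p q =>
    (S.covS.map star ⊗ₖ ((S.H p.1)ᴴ * G * W * Gᴴ * S.H q.1)) p.2 q.2

/-- The block row with blocks `B_i = (W Σ_s)^* ⊗ H_i`. -/
def matB (W : Matrix (Fin K) (Fin K) ℂ) : Matrix (Fin K × Fin M) (StackIdx L K N) ℂ :=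
  Matrix.of fun p q => ((W * S.covS).map star ⊗ₖ S.H q.1) p q.2

/-- The block diagonal matrix with blocks `C_i = Σ_i^* ⊗ (H_iᴴ G W Gᴴ H_i)`. -/
def matC (W : Matrix (Fin K) (Fin K) ℂ) (G : Matrix (Fin M) (Fin K) ℂ) :
    Matrix (StackIdx L K N) (StackIdx L K N) ℂ :=
  Matrix.blockDiagonal' fun i =>
    (S.covN i).map star ⊗ₖ ((S.H i)ᴴ * G * W * Gᴴ * S.H i)

/-- The block diagonal matrix whose `i`-th block is `(Σ_s + Σ_i)^* ⊗ I` and whose other blocks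
are zero. -/
def matD (i : Fin L) : Matrix (StackIdx L K N) (StackIdx L K N) ℂ :=
  Matrix.blockDiagonal' (Pi.single i
    ((S.covS + S.covN i).map star ⊗ₖ (1 : Matrix (Fin (N i)) (Fin (N i)) ℂ)))

/-- The constant `c = Tr (W Σ_s) + σ₀² Tr (G W Gᴴ)`. -/
def constC (W : Matrix (Fin K) (Fin K) ℂ) (G : Matrix (Fin M) (Fin K) ℂ) : ℝ :=
  (trace (W * S.covS)).re + S.σ₀ ^ 2 * (trace (G * W * Gᴴ)).re

/-- Feasibility of `(f, t, s)` for the second-order cone program of the precoder update with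
`W` and `G` fixed. -/
structure SOCPFeasible (W : Matrix (Fin K) (Fin K) ℂ) (G : Matrix (Fin M) (Fin K) ℂ)
    (f : StackIdx L K N → ℂ) (t s : ℝ) : Prop where
  objective : s - 2 * (star G.vec ⬝ᵥ (S.matB W *ᵥ f)).re + S.constC W G ≤ t
  quadratic : stackedNorm (CFC.sqrt (S.matA W G + S.matC W G) *ᵥ f) ((s - 1) / 2) ≤ (s + 1) / 2
  power : ∀ i, stackedNorm (CFC.sqrt (S.matD i) *ᵥ f) ((S.P i - 1) / 2) ≤ (S.P i + 1) / 2

/-- `f` is the `f`-part of an optimal solution `(f, t, s)` of the second-order cone program of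
minimizing `t` with `W` and `G` fixed. -/
def SolvesSOCP (W : Matrix (Fin K) (Fin K) ℂ) (G : Matrix (Fin M) (Fin K) ℂ)
    (f : StackIdx L K N → ℂ) : Prop :=
  ∃ t s : ℝ, S.SOCPFeasible W G f t s ∧
    ∀ (f' : StackIdx L K N → ℂ) (t' s' : ℝ), S.SOCPFeasible W G f' t' s' → t ≤ t'

/-- `(F, W, G)` is a sequence of iterates of the batch-mode block coordinate ascent algorithm,
run without stopping. -/
structure IsBatchModeBCA (F : ℕ → Precoders L K N) (W : ℕ → Matrix (Fin K) (Fin K) ℂ)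
    (G : ℕ → Matrix (Fin M) (Fin K) ℂ) : Prop where
  init : S.IsFeasible (F 0)
  stepF : ∀ j, S.SolvesSOCP (W j) (G j) (stackVec (F (j + 1)))
  stepG : ∀ j, G j = S.updateG (F j)
  stepW : ∀ j, W j = S.updateW (F j) (G j)

end SensorNetwork

end

/-! The algorithm is a minorize-maximize scheme. For positive definite `W` and any `G`,
`augmentedInfo` lies below `mutualInfo` as a function of `F` (`augmentedInfo_le_mutualInfo`):
completing the square in `G` and applying log x ≤ x - 1 to eigenvalues account for the gap. The gap
closes when `G` and `W` are the updates belonging to `F` (`augmentedInfo_update`). By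
`solvesSOCP_iff` the cone program minimizes Tr(W E) over the feasible precoders, so each step
maximizes the current minorant, and for every feasible F' aug(F', W_j, G_j) ≤ aug(F_{j+1}, W_j, G_j)
≤ MI(F_{j+1}). Taking F' = F_j gives monotonicity. The feasible set is compact and the updates are
continuous, so limit points exist. At a limit point F̄, letting j run along the subsequence shows
that F̄ maximizes its own minorant; neither uniqueness of the program's solution nor convergence of
the shifted iterates is needed. Since the minorant touches `mutualInfo` at F̄, the two derivatives
agree there, and `exists_multipliers` turns first-order optimality into the KKT conditions. -/

namespace Matrix

/-! ### Trace and log-determinant inequalities -/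

variable {m n : Type*} [Fintype m] [Fintype n] [DecidableEq m] [DecidableEq n]

theorem PosDef.det_re_pos {A : Matrix n n ℂ} (hA : A.PosDef) : 0 < A.det.re :=
  (Complex.pos_iff.1 hA.det_pos).1

theorem PosDef.ofReal_det_re {A : Matrix n n ℂ} (hA : A.PosDef) : (A.det.re : ℂ) = A.det :=
  Complex.ext rfl (Complex.pos_iff.1 hA.det_pos).2

theorem PosSemidef.sqrt_mul_sqrt {A : Matrix n n ℂ} (hA : A.PosSemidef) :
    CFC.sqrt A * CFC.sqrt A = A :=
  CFC.sqrt_mul_sqrt_self A hA.nonneg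

theorem conjTranspose_sqrt (A : Matrix n n ℂ) : (CFC.sqrt A)ᴴ = CFC.sqrt A :=
  (nonneg_iff_posSemidef.1 (CFC.sqrt_nonneg A)).isHermitian

theorem PosSemidef.trace_mul_nonneg {A B : Matrix n n ℂ} (hA : A.PosSemidef)
    (hB : B.PosSemidef) : 0 ≤ (A * B).trace := by
  have h := (hB.mul_mul_conjTranspose_same (CFC.sqrt A)).trace_nonneg
  rwa [conjTranspose_sqrt, trace_mul_comm, ← Matrix.mul_assoc, hA.sqrt_mul_sqrt] at h

theorem PosDef.log_det_le_trace_sub {A : Matrix n n ℂ} (hA : A.PosDef) :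
    Real.log A.det.re ≤ A.trace.re - Fintype.card n := by
  have hd : A.det.re = ∏ i, hA.1.eigenvalues i := by
    have h := congrArg Complex.re hA.1.det_eq_prod_eigenvalues
    simpa [← Complex.ofReal_prod] using h
  have ht : A.trace.re = ∑ i, hA.1.eigenvalues i := by
    have h := congrArg Complex.re hA.1.trace_eq_sum_eigenvalues
    simpa using h
  rw [hd, ht, Real.log_prod fun i _ => (hA.eigenvalues_pos i).ne']
  calc _ ≤ ∑ i, (hA.1.eigenvalues i - 1) :=
        Finset.sum_le_sum fun i _ => Real.log_le_sub_one_of_pos (hA.eigenvalues_pos i)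
    _ = _ := by simp

/-- The product AB need not be Hermitian, but √A B √A is positive definite with the same determinant
and trace, so the one-matrix bound applies to it. -/
theorem PosDef.log_det_add_log_det_le {A B : Matrix n n ℂ} (hA : A.PosDef) (hB : B.PosDef) :
    Real.log A.det.re + Real.log B.det.re ≤ (A * B).trace.re - Fintype.card n := by
  have hs := hA.posSemidef.sqrt_mul_sqrt
  have hdet : (CFC.sqrt A * B * CFC.sqrt A).det = A.det * B.det := by
    rw [det_mul_comm, ← Matrix.mul_assoc, hs, det_mul]
  have hC : (CFC.sqrt A * B * CFC.sqrt A).PosDef := by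
    have h := hB.posSemidef.mul_mul_conjTranspose_same (CFC.sqrt A)
    rw [conjTranspose_sqrt] at h
    rw [h.posDef_iff_det_ne_zero, hdet]
    exact mul_ne_zero hA.det_pos.ne' hB.det_pos.ne'
  have h := hC.log_det_le_trace_sub
  rw [hdet, ← hA.ofReal_det_re, ← hB.ofReal_det_re, ← Complex.ofReal_mul, Complex.ofReal_re,
    Real.log_mul hA.det_re_pos.ne' hB.det_re_pos.ne', trace_mul_comm, ← Matrix.mul_assoc, hs] at h
  exact h

theorem PosDef.inv_det_re {A : Matrix n n ℂ} (hA : A.PosDef) : A⁻¹.det.re = (A.det.re)⁻¹ := by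
  rw [det_nonsing_inv, Ring.inverse_eq_inv', ← hA.ofReal_det_re, ← Complex.ofReal_inv,
    Complex.ofReal_re, Complex.ofReal_re]

end Matrix

/-! ### The error covariance and the minorant of the mutual information -/

namespace SensorNetwork

variable {L K M : ℕ} {N : Fin L → ℕ} (S : SensorNetwork L K M N)

/-- The covariance `H̃ Σ_s H̃ᴴ + Σ_n` of the received signal. -/
def receivedCov (F : Precoders L K N) : Matrix (Fin M) (Fin M) ℂ :=
  S.effChannel F * S.covS * (S.effChannel F)ᴴ + S.noiseCov F

variable {S} (hcovS : S.covS.PosDef) (hcovN : ∀ i, (S.covN i).PosSemidef) (hσ₀ : 0 < S.σ₀)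

include hcovN hσ₀ in
theorem noiseCov_posDef (F : Precoders L K N) : (S.noiseCov F).PosDef := by
  refine PosDef.add_posSemidef ?_ (posSemidef_sum _ fun i _ => ?_)
  · have h : (0 : ℂ) < (S.σ₀ : ℂ) ^ 2 := by
      rw [← Complex.ofReal_pow]; exact_mod_cast pow_pos hσ₀ 2
    exact PosDef.one.smul h
  · have h := (hcovN i).mul_mul_conjTranspose_same (S.H i * F i)
    simpa only [conjTranspose_mul, Matrix.mul_assoc] using h

include hcovS hcovN hσ₀ in
theorem receivedCov_posDef (F : Precoders L K N) : (S.receivedCov F).PosDef :=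
  PosDef.posSemidef_add (hcovS.posSemidef.mul_mul_conjTranspose_same _)
    (noiseCov_posDef hcovN hσ₀ F)

include hcovS in
theorem mseMatrix_eq (F : Precoders L K N) (G : Matrix (Fin M) (Fin K) ℂ) :
    S.mseMatrix F G = S.covS - Gᴴ * (S.effChannel F * S.covS)
      - (S.effChannel F * S.covS)ᴴ * G + Gᴴ * S.receivedCov F * G := by
  have h : S.covSᴴ = S.covS := hcovS.1
  simp only [mseMatrix, receivedCov, conjTranspose_sub, conjTranspose_one, conjTranspose_mul,
    conjTranspose_conjTranspose, h, Matrix.mul_sub, Matrix.sub_mul, Matrix.mul_add, Matrix.add_mul,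
    Matrix.mul_one, Matrix.one_mul, Matrix.mul_assoc]
  abel

-- These are the normal equations of linear MMSE estimation; later arguments use them in place of
-- the explicit inverse.
include hcovS hcovN hσ₀ in
theorem receivedCov_mul_updateG (F : Precoders L K N) :
    S.receivedCov F * S.updateG F = S.effChannel F * S.covS := by
  have h : IsUnit (S.receivedCov F).det :=
    (isUnit_iff_isUnit_det _).1 (receivedCov_posDef hcovS hcovN hσ₀ F).isUnit
  rw [updateG, ← receivedCov, Matrix.mul_assoc, mul_nonsing_inv_cancel_left _ _ h]

include hcovS hcovN hσ₀ in
theorem mseMatrix_updateG (F : Precoders L K N) :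
    S.mseMatrix F (S.updateG F) = S.covS - (S.effChannel F * S.covS)ᴴ * S.updateG F := by
  rw [mseMatrix_eq hcovS, Matrix.mul_assoc (S.updateG F)ᴴ,
    receivedCov_mul_updateG hcovS hcovN hσ₀ F]
  abel

-- Completion of the square around the MMSE postcoder: the normal equations cancel the cross terms.
include hcovS hcovN hσ₀ in
theorem mseMatrix_eq_add (F : Precoders L K N) (G : Matrix (Fin M) (Fin K) ℂ) :
    S.mseMatrix F G = S.mseMatrix F (S.updateG F)
      + (G - S.updateG F)ᴴ * S.receivedCov F * (G - S.updateG F) := by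
  have h := receivedCov_mul_updateG hcovS hcovN hσ₀ F
  have h' : (S.updateG F)ᴴ * S.receivedCov F = (S.effChannel F * S.covS)ᴴ := by
    rw [← h, conjTranspose_mul, (receivedCov_posDef hcovS hcovN hσ₀ F).1.eq]
  rw [mseMatrix_updateG hcovS hcovN hσ₀, mseMatrix_eq hcovS, conjTranspose_sub, Matrix.sub_mul,
    h', Matrix.sub_mul, Matrix.mul_sub, Matrix.mul_sub, Matrix.mul_assoc Gᴴ _ (S.updateG F), h]
  abel

-- Sylvester's identity det(1 - XY) = det(1 - YX) passes from K × K to M × M matrices, where the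
-- received covariance absorbs the factor and leaves the noise covariance.
include hcovS hcovN hσ₀ in
theorem det_mseMatrix_updateG (F : Precoders L K N) :
    (S.mseMatrix F (S.updateG F)).det * (S.receivedCov F).det
      = S.covS.det * (S.noiseCov F).det := by
  have h : IsUnit (S.receivedCov F).det :=
    (isUnit_iff_isUnit_det _).1 (receivedCov_posDef hcovS hcovN hσ₀ F).isUnit
  have h1 : S.mseMatrix F (S.updateG F) =
      S.covS * (1 - (S.effChannel F)ᴴ * ((S.receivedCov F)⁻¹ * S.effChannel F * S.covS)) := by
    rw [mseMatrix_updateG hcovS hcovN hσ₀, conjTranspose_mul, hcovS.1.eq, updateG, ← receivedCov,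
      Matrix.mul_sub, Matrix.mul_one, Matrix.mul_assoc]
  have h2 : S.receivedCov F * (1 - (S.receivedCov F)⁻¹ * S.effChannel F * S.covS
      * (S.effChannel F)ᴴ) = S.noiseCov F := by
    rw [Matrix.mul_sub, Matrix.mul_one, Matrix.mul_assoc, Matrix.mul_assoc,
      mul_nonsing_inv_cancel_left _ _ h, ← Matrix.mul_assoc, receivedCov, add_sub_cancel_left]
  rw [h1, det_mul, det_one_sub_mul_comm, mul_assoc, mul_comm (det _) (det (S.receivedCov F)),
    ← det_mul, h2]

-- Semidefiniteness is visible from the definition. Strictness comes from the determinant identity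
-- at the MMSE postcoder; any other postcoder only adds a semidefinite term.
include hcovS hcovN hσ₀ in
theorem mseMatrix_posDef (F : Precoders L K N) (G : Matrix (Fin M) (Fin K) ℂ) :
    (S.mseMatrix F G).PosDef := by
  have h : (S.mseMatrix F (S.updateG F)).PosSemidef :=
    (hcovS.posSemidef.mul_mul_conjTranspose_same _).add
      ((noiseCov_posDef hcovN hσ₀ F).posSemidef.conjTranspose_mul_mul_same _)
  have h' : (S.mseMatrix F (S.updateG F)).PosDef := by
    rw [h.posDef_iff_det_ne_zero]
    refine left_ne_zero_of_mul (b := (S.receivedCov F).det) ?_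
    rw [det_mseMatrix_updateG hcovS hcovN hσ₀]
    exact mul_ne_zero hcovS.det_pos.ne' (noiseCov_posDef hcovN hσ₀ F).det_pos.ne'
  rw [mseMatrix_eq_add hcovS hcovN hσ₀]
  exact h'.add_posSemidef
    ((receivedCov_posDef hcovS hcovN hσ₀ F).posSemidef.conjTranspose_mul_mul_same _)

include hcovS hcovN hσ₀ in
theorem updateW_posDef (F : Precoders L K N) (G : Matrix (Fin M) (Fin K) ℂ) :
    (S.updateW F G).PosDef :=
  (mseMatrix_posDef hcovS hcovN hσ₀ F G).inv

include hcovS hcovN hσ₀ in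
theorem mutualInfo_eq (F : Precoders L K N) : S.mutualInfo F =
    Real.log (S.receivedCov F).det.re - Real.log (S.noiseCov F).det.re := by
  have hn := noiseCov_posDef hcovN hσ₀ F
  have hT := receivedCov_posDef hcovS hcovN hσ₀ F
  have h : (1 + S.effChannel F * S.covS * (S.effChannel F)ᴴ * (S.noiseCov F)⁻¹)
      = S.receivedCov F * (S.noiseCov F)⁻¹ := by
    rw [receivedCov, Matrix.add_mul,
      mul_nonsing_inv _ ((isUnit_iff_isUnit_det _).1 hn.isUnit), add_comm]
  rw [mutualInfo, h, det_mul, ← hT.ofReal_det_re, Complex.re_ofReal_mul, hn.inv_det_re,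
    Complex.ofReal_re, Real.log_mul hT.det_re_pos.ne' (inv_pos.2 hn.det_re_pos).ne', Real.log_inv,
    sub_eq_add_neg]

include hcovS hcovN hσ₀ in
theorem mutualInfo_eq_log_det_mse (F : Precoders L K N) : S.mutualInfo F =
    Real.log S.covS.det.re - Real.log (S.mseMatrix F (S.updateG F)).det.re := by
  have hn := noiseCov_posDef hcovN hσ₀ F
  have hT := receivedCov_posDef hcovS hcovN hσ₀ F
  have hE := mseMatrix_posDef hcovS hcovN hσ₀ F (S.updateG F)
  have h := det_mseMatrix_updateG hcovS hcovN hσ₀ F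
  rw [← hn.ofReal_det_re, ← hT.ofReal_det_re, ← hE.ofReal_det_re, ← hcovS.ofReal_det_re,
    ← Complex.ofReal_mul, ← Complex.ofReal_mul, Complex.ofReal_inj] at h
  have h' := congrArg Real.log h
  rw [Real.log_mul hE.det_re_pos.ne' hT.det_re_pos.ne',
    Real.log_mul hcovS.det_re_pos.ne' hn.det_re_pos.ne'] at h'
  rw [mutualInfo_eq hcovS hcovN hσ₀]
  linarith

include hcovS hcovN hσ₀ in
theorem augmentedInfo_update (F : Precoders L K N) :
    S.augmentedInfo F (S.updateW F (S.updateG F)) (S.updateG F) = S.mutualInfo F := by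
  have hE := mseMatrix_posDef hcovS hcovN hσ₀ F (S.updateG F)
  rw [mutualInfo_eq_log_det_mse hcovS hcovN hσ₀, augmentedInfo, updateW, hE.inv_det_re,
    Real.log_inv, nonsing_inv_mul _ ((isUnit_iff_isUnit_det _).1 hE.isUnit), trace_one]
  simp
  ring

-- Two separate losses: a postcoder other than the MMSE one costs a nonnegative trace, and a weight
-- other than the inverse error covariance costs the slack in `log_det_add_log_det_le`.
include hcovS hcovN hσ₀ in
theorem augmentedInfo_le_mutualInfo (F : Precoders L K N) {W : Matrix (Fin K) (Fin K) ℂ}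
    (hW : W.PosDef) (G : Matrix (Fin M) (Fin K) ℂ) :
    S.augmentedInfo F W G ≤ S.mutualInfo F := by
  have h := hW.log_det_add_log_det_le (mseMatrix_posDef hcovS hcovN hσ₀ F (S.updateG F))
  have h' := (Complex.nonneg_iff.1 (hW.posSemidef.trace_mul_nonneg ((receivedCov_posDef hcovS hcovN
    hσ₀ F).posSemidef.conjTranspose_mul_mul_same (G - S.updateG F)))).1
  rw [mutualInfo_eq_log_det_mse hcovS hcovN hσ₀, augmentedInfo, mseMatrix_eq_add hcovS hcovN hσ₀,
    Matrix.mul_add, trace_add, Complex.add_re]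
  rw [Fintype.card_fin] at h
  linarith

end SensorNetwork

/-! ### The cone program as weighted mean-square-error minimization -/

theorem stackedNorm_sq {ι : Type*} [Fintype ι] (v : ι → ℂ) (r : ℝ) :
    stackedNorm v r ^ 2 = (star v ⬝ᵥ v).re + r ^ 2 := by
  rw [stackedNorm, EuclideanSpace.norm_sq_eq, Fintype.sum_sum_type, dotProduct, Complex.re_sum]
  congr 1
  · refine Finset.sum_congr rfl fun i _ => ?_
    simp [Complex.sq_norm, Complex.normSq_apply]
  · simp

/-- Squaring suffices because ((s + 1)/2)² - ((s - 1)/2)² = s; going back, s ≥ 0 follows from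
semidefiniteness of Q. -/
theorem stackedNorm_sqrt_mulVec_le_iff {ι : Type*} [Fintype ι] [DecidableEq ι] {Q : Matrix ι ι ℂ}
    (hQ : Q.PosSemidef) (v : ι → ℂ) (s : ℝ) :
    stackedNorm (CFC.sqrt Q *ᵥ v) ((s - 1) / 2) ≤ (s + 1) / 2 ↔ (star v ⬝ᵥ Q *ᵥ v).re ≤ s := by
  have h : star (CFC.sqrt Q *ᵥ v) ⬝ᵥ CFC.sqrt Q *ᵥ v = star v ⬝ᵥ Q *ᵥ v := by
    rw [star_mulVec, conjTranspose_sqrt, ← dotProduct_mulVec, mulVec_mulVec, hQ.sqrt_mul_sqrt]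
  have h0 : 0 ≤ (star v ⬝ᵥ Q *ᵥ v).re := (Complex.nonneg_iff.1 (hQ.dotProduct_mulVec_nonneg v)).1
  have hn : 0 ≤ stackedNorm (CFC.sqrt Q *ᵥ v) ((s - 1) / 2) := norm_nonneg _
  have hsq := stackedNorm_sq (CFC.sqrt Q *ᵥ v) ((s - 1) / 2)
  rw [h] at hsq
  constructor
  · intro hle
    have := pow_le_pow_left₀ hn hle 2
    linarith
  · intro hle
    refine le_of_sq_le_sq ?_ (by linarith)
    linarith

section Stack

variable {L K : ℕ} {N : Fin L → ℕ}

theorem stackVec_surjective : Function.Surjective (stackVec (L := L) (K := K) (N := N)) :=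
  fun f => ⟨fun i => Matrix.of fun a k => f ⟨i, k, a⟩, rfl⟩

theorem star_stackVec_dotProduct (F F' : Precoders L K N) :
    star (stackVec F) ⬝ᵥ stackVec F' = ∑ i, trace ((F i)ᴴ * F' i) := by
  rw [dotProduct, Fintype.sum_sigma]
  exact Finset.sum_congr rfl fun i _ => star_vec_dotProduct_vec (F i) (F' i)

theorem blockDiagonal'_kronecker_mulVec_stackVec (A : Fin L → Matrix (Fin K) (Fin K) ℂ)
    (B : (i : Fin L) → Matrix (Fin (N i)) (Fin (N i)) ℂ) (F : Precoders L K N) :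
    Matrix.blockDiagonal' (fun i => A i ⊗ₖ B i) *ᵥ stackVec F
      = stackVec fun i => B i * F i * (A i)ᵀ := by
  ext ⟨i, p⟩
  rw [stackVec, ← kronecker_mulVec_vec, mulVec, dotProduct, Fintype.sum_sigma,
    Finset.sum_eq_single i]
  · simp [mulVec, dotProduct, stackVec]
  · intro j _ hj
    simp [blockDiagonal'_apply_ne _ _ _ hj.symm]
  · simp

end Stack

namespace Matrix

/-- Explains the conjugates in the program's data: (A ⊗ B) vec X = vec(B X Aᵀ) transposes the left
factor, and for A = Σ^* with Σ Hermitian this restores Σ. -/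
theorem IsHermitian.transpose_map_star {n : Type*} {A : Matrix n n ℂ} (hA : A.IsHermitian) :
    (A.map star)ᵀ = A := hA

end Matrix

namespace SensorNetwork

variable {L K M : ℕ} {N : Fin L → ℕ} {S : SensorNetwork L K M N}

/-- Moves `Pi.single` inside the Kronecker factor, so that every block, including the zero ones, is
a Kronecker product. -/
theorem matD_eq (S : SensorNetwork L K M N) (i : Fin L) :
    S.matD i = Matrix.blockDiagonal' fun j =>
      ((Pi.single i (S.covS + S.covN i) : Fin L → Matrix (Fin K) (Fin K) ℂ) j).map star
        ⊗ₖ (1 : Matrix (Fin (N j)) (Fin (N j)) ℂ) := by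
  rw [matD]
  congr 1
  ext1 j
  rcases eq_or_ne j i with rfl | h
  · simp
  · simp [h]

variable (hcovS : S.covS.PosDef) (hcovN : ∀ i, (S.covN i).PosSemidef) (hσ₀ : 0 < S.σ₀)

include hcovS hcovN in
theorem covS_add_covN_posDef (i : Fin L) : (S.covS + S.covN i).PosDef :=
  hcovS.add_posSemidef (hcovN i)

include hcovS hcovN in
theorem matD_form (F : Precoders L K N) (i : Fin L) :
    star (stackVec F) ⬝ᵥ S.matD i *ᵥ stackVec F = trace (F i * (S.covS + S.covN i) * (F i)ᴴ) := by
  rw [matD_eq, blockDiagonal'_kronecker_mulVec_stackVec, star_stackVec_dotProduct,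
    Finset.sum_eq_single i]
  · rw [Pi.single_eq_same, (covS_add_covN_posDef hcovS hcovN i).1.transpose_map_star,
      Matrix.one_mul, trace_mul_comm]
  · intro j _ hj
    simp [Pi.single_eq_of_ne hj]
  · simp

include hcovS hcovN in
theorem trace_power_nonneg (F : Precoders L K N) (i : Fin L) :
    0 ≤ trace (F i * (S.covS + S.covN i) * (F i)ᴴ) :=
  ((covS_add_covN_posDef hcovS hcovN i).posSemidef.mul_mul_conjTranspose_same (F i)).trace_nonneg

include hcovS hcovN in
theorem matD_posSemidef (i : Fin L) : (S.matD i).PosSemidef := by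
  refine .of_dotProduct_mulVec_nonneg ?_ fun f => ?_
  · rw [matD_eq, IsHermitian, blockDiagonal'_conjTranspose]
    congr 1
    ext1 j
    rw [conjTranspose_kronecker, conjTranspose_one]
    congr 1
    rcases eq_or_ne j i with rfl | h
    · have := (covS_add_covN_posDef hcovS hcovN j).1
      rw [Pi.single_eq_same]
      exact congrArg (fun X => X.map star) this
    · simp [Pi.single_eq_of_ne h]
  · obtain ⟨F, rfl⟩ := stackVec_surjective f
    rw [matD_form hcovS hcovN]
    exact trace_power_nonneg hcovS hcovN F i

variable {W : Matrix (Fin K) (Fin K) ℂ} (hW : W.PosDef) (G : Matrix (Fin M) (Fin K) ℂ)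

include hcovN in
theorem matC_form (F : Precoders L K N) :
    star (stackVec F) ⬝ᵥ S.matC W G *ᵥ stackVec F
      = trace ((G * W * Gᴴ) * ∑ i, S.H i * F i * S.covN i * (F i)ᴴ * (S.H i)ᴴ) := by
  rw [matC, blockDiagonal'_kronecker_mulVec_stackVec, star_stackVec_dotProduct, Matrix.mul_sum,
    trace_sum]
  refine Finset.sum_congr rfl fun i _ => ?_
  rw [(hcovN i).1.transpose_map_star, ← Matrix.mul_assoc, trace_mul_comm, ← Matrix.mul_assoc,
    ← Matrix.mul_assoc]
  simp only [Matrix.mul_assoc]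
  rw [trace_mul_comm]
  simp only [Matrix.mul_assoc]
  rw [trace_mul_comm]
  simp only [Matrix.mul_assoc]
  rw [trace_mul_comm]
  simp only [Matrix.mul_assoc]

include hcovS in
theorem matA_mulVec_stackVec (F : Precoders L K N) :
    S.matA W G *ᵥ stackVec F
      = stackVec fun i => (S.H i)ᴴ * G * W * Gᴴ * S.effChannel F * S.covS := by
  ext ⟨i, p⟩
  change _ = ((S.H i)ᴴ * G * W * Gᴴ * S.effChannel F * S.covS).vec p
  rw [mulVec, dotProduct, Fintype.sum_sigma, effChannel, Matrix.mul_sum, Matrix.sum_mul,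
    vec_sum, Finset.sum_apply]
  refine Finset.sum_congr rfl fun j _ => ?_
  have h := congrFun (kronecker_mulVec_vec ((S.H i)ᴴ * G * W * Gᴴ * S.H j) (F j)
    (S.covS.map star)) p
  rw [hcovS.1.transpose_map_star] at h
  rw [← Matrix.mul_assoc _ (S.H j), ← h]
  rfl

include hcovS in
theorem matA_form (F : Precoders L K N) :
    star (stackVec F) ⬝ᵥ S.matA W G *ᵥ stackVec F
      = trace ((G * W * Gᴴ) * (S.effChannel F * S.covS * (S.effChannel F)ᴴ)) := by
  rw [matA_mulVec_stackVec hcovS, star_stackVec_dotProduct, ← trace_sum]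
  have h : ∑ i, (F i)ᴴ * ((S.H i)ᴴ * G * W * Gᴴ * S.effChannel F * S.covS)
      = (S.effChannel F)ᴴ * (G * W * Gᴴ * S.effChannel F * S.covS) := by
    simp only [effChannel, conjTranspose_sum, conjTranspose_mul, Matrix.sum_mul, Matrix.mul_assoc]
  rw [h, trace_mul_comm]
  simp only [Matrix.mul_assoc]

theorem matB_mulVec_stackVec (F : Precoders L K N) :
    S.matB W *ᵥ stackVec F = (S.effChannel F * (W * S.covS)ᴴ).vec := by
  ext p
  rw [mulVec, dotProduct, Fintype.sum_sigma, effChannel, Matrix.sum_mul, vec_sum,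
    Finset.sum_apply]
  refine Finset.sum_congr rfl fun j _ => ?_
  exact congrFun (kronecker_mulVec_vec (S.H j) (F j) ((W * S.covS).map star)) p

include hW in
theorem postcoded_posSemidef : (G * W * Gᴴ).PosSemidef :=
  hW.posSemidef.mul_mul_conjTranspose_same G

-- Needed so that `CFC.sqrt` squares back to the matrix. Positivity is tested on stacked vectors,
-- where each form is the trace of a product of two semidefinite matrices.
include hcovS hcovN hW in
theorem matA_add_matC_posSemidef : (S.matA W G + S.matC W G).PosSemidef := by
  have hY := (postcoded_posSemidef hW G)
  have hX : ∀ i j, ((S.H i)ᴴ * G * W * Gᴴ * S.H j)ᴴ = (S.H j)ᴴ * G * W * Gᴴ * S.H i := by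
    intro i j
    simp only [conjTranspose_mul, conjTranspose_conjTranspose, hW.1.eq, Matrix.mul_assoc]
  refine .add ?_ ?_
  · refine .of_dotProduct_mulVec_nonneg ?_ fun f => ?_
    · ext p q
      have h1 := congrFun (congrFun (hX q.1 p.1) p.2.2) q.2.2
      have h2 := congrFun (congrFun hcovS.1 p.2.1) q.2.1
      rw [conjTranspose_apply] at h1 h2
      simp only [matA, conjTranspose_apply, Matrix.of_apply, kroneckerMap_apply, Matrix.map_apply,
        star_mul', h1, h2]
    · obtain ⟨F, rfl⟩ := stackVec_surjective f
      rw [matA_form hcovS]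
      exact hY.trace_mul_nonneg (hcovS.posSemidef.mul_mul_conjTranspose_same _)
  · refine .of_dotProduct_mulVec_nonneg ?_ fun f => ?_
    · rw [matC, IsHermitian, blockDiagonal'_conjTranspose]
      congr 1
      ext1 j
      rw [conjTranspose_kronecker, hX]
      congr 1
      exact congrArg (fun X => X.map star) (hcovN j).1
    · obtain ⟨F, rfl⟩ := stackVec_surjective f
      rw [matC_form hcovN]
      refine hY.trace_mul_nonneg (posSemidef_sum _ fun i _ => ?_)
      have h := (hcovN i).mul_mul_conjTranspose_same (S.H i * F i)
      simpa only [conjTranspose_mul, Matrix.mul_assoc] using h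

include hcovS hcovN hW in
theorem quadratic_objective_eq (F : Precoders L K N) :
    (star (stackVec F) ⬝ᵥ (S.matA W G + S.matC W G) *ᵥ stackVec F).re
      - 2 * (star G.vec ⬝ᵥ (S.matB W *ᵥ stackVec F)).re + S.constC W G
      = (trace (W * S.mseMatrix F G)).re := by
  have hE : S.mseMatrix F G = S.covS - Gᴴ * S.effChannel F * S.covS
      - (Gᴴ * S.effChannel F * S.covS)ᴴ + Gᴴ * S.effChannel F * S.covS * (S.effChannel F)ᴴ * G
      + (((S.σ₀ ^ 2 : ℝ) : ℂ) • (Gᴴ * G)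
      + Gᴴ * (∑ i, S.H i * F i * S.covN i * (F i)ᴴ * (S.H i)ᴴ) * G) := by
    rw [mseMatrix_eq hcovS, receivedCov, noiseCov, Complex.ofReal_pow]
    simp only [conjTranspose_mul, conjTranspose_conjTranspose, Matrix.mul_add, Matrix.add_mul,
      Matrix.mul_smul, Matrix.smul_mul, Matrix.mul_one, Matrix.mul_assoc]
    abel
  have hB : (star G.vec ⬝ᵥ (S.matB W *ᵥ stackVec F))
      = trace (W * (Gᴴ * S.effChannel F * S.covS)) := by
    rw [matB_mulVec_stackVec, star_vec_dotProduct_vec, conjTranspose_mul, hcovS.1.eq, hW.1.eq,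
      trace_mul_comm W]
    simp only [Matrix.mul_assoc]
  -- The two cross terms of E contribute conjugate traces, whence the factor 2 Re in the program.
  have hB' : (trace (W * (Gᴴ * S.effChannel F * S.covS)ᴴ)).re
      = (trace (W * (Gᴴ * S.effChannel F * S.covS))).re := by
    rw [trace_mul_comm, ← congrArg (_ * ·) hW.1.eq]
    rw [← conjTranspose_mul, trace_conjTranspose]
    rfl
  have hcyc : ∀ X : Matrix (Fin M) (Fin M) ℂ,
      trace (G * W * Gᴴ * X) = trace (W * (Gᴴ * X * G)) := by
    intro X
    rw [Matrix.mul_assoc, Matrix.mul_assoc, trace_mul_comm, Matrix.mul_assoc]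
  simp only [Matrix.mul_assoc] at hB'
  have h1 := hcyc 1
  rw [Matrix.mul_one, Matrix.mul_one] at h1
  rw [add_mulVec, dotProduct_add, matA_form hcovS, matC_form hcovN, hB, constC, hcyc, hcyc, h1, hE]
  simp only [Matrix.mul_add, Matrix.mul_sub, trace_add, trace_sub, Complex.add_re, Complex.sub_re,
    hB', Matrix.mul_smul, trace_smul, smul_eq_mul, Complex.re_ofReal_mul, Matrix.mul_assoc]
  ring

include hcovS hcovN hW in
theorem socpFeasible_iff (F : Precoders L K N) (t s : ℝ) :
    S.SOCPFeasible W G (stackVec F) t s ↔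
      s - 2 * (star G.vec ⬝ᵥ (S.matB W *ᵥ stackVec F)).re + S.constC W G ≤ t ∧
      (star (stackVec F) ⬝ᵥ (S.matA W G + S.matC W G) *ᵥ stackVec F).re ≤ s ∧
      S.IsFeasible F := by
  have h1 := stackedNorm_sqrt_mulVec_le_iff (matA_add_matC_posSemidef hcovS hcovN hW G)
    (stackVec F) s
  have h2 : ∀ i, _ := fun i => stackedNorm_sqrt_mulVec_le_iff (matD_posSemidef hcovS hcovN i)
    (stackVec F) (S.P i)
  simp only [matD_form hcovS hcovN] at h2
  constructor
  · rintro ⟨a, b, c⟩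
    exact ⟨a, h1.1 b, fun i => (h2 i).1 (c i)⟩
  · rintro ⟨a, b, c⟩
    exact ⟨a, h1.2 b, fun i => (h2 i).2 (c i)⟩

-- The variables t and s are epigraph variables: comparing with their tight values eliminates both.
include hcovS hcovN hW in
theorem solvesSOCP_iff (F : Precoders L K N) :
    S.SolvesSOCP W G (stackVec F) ↔ S.IsFeasible F ∧ ∀ F', S.IsFeasible F' →
      (trace (W * S.mseMatrix F G)).re ≤ (trace (W * S.mseMatrix F' G)).re := by
  constructor
  · rintro ⟨t, s, hf, hmin⟩
    rw [socpFeasible_iff hcovS hcovN hW] at hf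
    refine ⟨hf.2.2, fun F' hF' => ?_⟩
    have h := hmin (stackVec F') _ _
      ((socpFeasible_iff hcovS hcovN hW G F' _ _).2 ⟨le_rfl, le_rfl, hF'⟩)
    rw [quadratic_objective_eq hcovS hcovN hW] at h
    rw [← quadratic_objective_eq hcovS hcovN hW G F]
    linarith [hf.1, hf.2.1]
  · rintro ⟨hF, hmin⟩
    refine ⟨_, _, (socpFeasible_iff hcovS hcovN hW G F _ _).2 ⟨le_rfl, le_rfl, hF⟩, ?_⟩
    intro f' t' s' hf'
    obtain ⟨F', rfl⟩ := stackVec_surjective f'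
    rw [socpFeasible_iff hcovS hcovN hW] at hf'
    have h := hmin F' hf'.2.2
    rw [quadratic_objective_eq hcovS hcovN hW]
    rw [← quadratic_objective_eq hcovS hcovN hW G F'] at h
    linarith [hf'.1, hf'.2.1]

end SensorNetwork

/-! ### Differentiability of matrix expressions, entry by entry -/

section EntrywiseDifferentiability

variable {E : Type*} [NormedAddCommGroup E] [NormedSpace ℝ E]
variable {l m n : Type*} [Fintype m]

/-- All entries of the matrix-valued function `f` are real differentiable. -/
def EntrywiseDifferentiable (f : E → Matrix l n ℂ) : Prop :=
  ∀ a b, Differentiable ℝ fun x => f x a b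

namespace EntrywiseDifferentiable

theorem const (A : Matrix l n ℂ) : EntrywiseDifferentiable fun _ : E => A :=
  fun _ _ => differentiable_const _

theorem add {f g : E → Matrix l n ℂ} (hf : EntrywiseDifferentiable f)
    (hg : EntrywiseDifferentiable g) : EntrywiseDifferentiable fun x => f x + g x :=
  fun a b => (hf a b).add (hg a b)

theorem sub {f g : E → Matrix l n ℂ} (hf : EntrywiseDifferentiable f)
    (hg : EntrywiseDifferentiable g) : EntrywiseDifferentiable fun x => f x - g x :=
  fun a b => (hf a b).sub (hg a b)

theorem mul {f : E → Matrix l m ℂ} {g : E → Matrix m n ℂ} (hf : EntrywiseDifferentiable f)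
    (hg : EntrywiseDifferentiable g) : EntrywiseDifferentiable fun x => f x * g x := by
  intro a b
  simp only [mul_apply]
  exact Differentiable.fun_sum fun c _ => (hf a c).mul (hg c b)

theorem sum {ι : Type*} [Fintype ι] {f : ι → E → Matrix l n ℂ}
    (hf : ∀ i, EntrywiseDifferentiable (f i)) : EntrywiseDifferentiable fun x => ∑ i, f i x := by
  intro a b
  simp only [Matrix.sum_apply]
  exact Differentiable.fun_sum fun c _ => hf c a b

theorem conjTranspose {f : E → Matrix l n ℂ} (hf : EntrywiseDifferentiable f) :
    EntrywiseDifferentiable fun x => (f x)ᴴ :=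
  fun a b => (hf b a).star

theorem trace_re {f : E → Matrix m m ℂ} (hf : EntrywiseDifferentiable f) :
    Differentiable ℝ fun x => (f x).trace.re :=
  Complex.reCLM.differentiable.comp (Differentiable.fun_sum fun c _ => hf c c)

theorem det_re [DecidableEq m] {f : E → Matrix m m ℂ} (hf : EntrywiseDifferentiable f) :
    Differentiable ℝ fun x => (f x).det.re := by
  refine Complex.reCLM.differentiable.comp ?_
  simp only [det_apply]
  refine Differentiable.fun_sum fun σ _ => Differentiable.fun_const_smul ?_ _
  exact fun x => (HasFDerivAt.finsetProd fun c _ => (hf (σ c) c x).hasFDerivAt).differentiableAt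

end EntrywiseDifferentiable

end EntrywiseDifferentiability

/-! ### Derivatives of objective and constraints, and the KKT multipliers -/

namespace SensorNetwork

section Normed

attribute [local instance] Matrix.normedAddCommGroup Matrix.normedSpace

variable {L K M : ℕ} {N : Fin L → ℕ} (S : SensorNetwork L K M N)

theorem entrywiseDifferentiable_block (i : Fin L) :
    EntrywiseDifferentiable fun F : Precoders L K N => F i := by
  intro a b
  exact (((ContinuousLinearMap.proj (R := ℝ) (φ := fun _ : Fin K => ℂ) b).comp
    (ContinuousLinearMap.proj (R := ℝ) (φ := fun _ : Fin (N i) => Fin K → ℂ) a)).comp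
    (ContinuousLinearMap.proj (R := ℝ)
      (φ := fun i : Fin L => Fin (N i) → Fin K → ℂ) i)).differentiable

theorem entrywiseDifferentiable_effChannel : EntrywiseDifferentiable S.effChannel :=
  .sum fun i => (EntrywiseDifferentiable.const _).mul (entrywiseDifferentiable_block i)

theorem entrywiseDifferentiable_noiseCov : EntrywiseDifferentiable S.noiseCov :=
  (EntrywiseDifferentiable.const _).add <| .sum fun i =>
    ((((EntrywiseDifferentiable.const _).mul (entrywiseDifferentiable_block i)).mul
      (.const _)).mul (entrywiseDifferentiable_block i).conjTranspose).mul (.const _)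

theorem entrywiseDifferentiable_receivedCov : EntrywiseDifferentiable S.receivedCov :=
  ((S.entrywiseDifferentiable_effChannel.mul (.const _)).mul
    S.entrywiseDifferentiable_effChannel.conjTranspose).add S.entrywiseDifferentiable_noiseCov

theorem entrywiseDifferentiable_mseMatrix (G : Matrix (Fin M) (Fin K) ℂ) :
    EntrywiseDifferentiable fun F => S.mseMatrix F G := by
  have h : EntrywiseDifferentiable fun F => 1 - Gᴴ * S.effChannel F :=
    (EntrywiseDifferentiable.const _).sub
      ((EntrywiseDifferentiable.const _).mul S.entrywiseDifferentiable_effChannel)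
  exact ((h.mul (.const _)).mul h.conjTranspose).add
    (((EntrywiseDifferentiable.const _).mul S.entrywiseDifferentiable_noiseCov).mul (.const _))

theorem differentiable_augmentedInfo (W : Matrix (Fin K) (Fin K) ℂ)
    (G : Matrix (Fin M) (Fin K) ℂ) : Differentiable ℝ fun F => S.augmentedInfo F W G :=
  ((((EntrywiseDifferentiable.const W).mul
    (S.entrywiseDifferentiable_mseMatrix G)).trace_re.const_sub _).add_const _).add_const _

theorem differentiable_power (i : Fin L) : Differentiable ℝ fun F => S.power F i :=
  (((entrywiseDifferentiable_block i).mul (.const _)).mul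
    (entrywiseDifferentiable_block i).conjTranspose).trace_re

variable {S} (hcovS : S.covS.PosDef) (hcovN : ∀ i, (S.covN i).PosSemidef) (hσ₀ : 0 < S.σ₀)

include hcovS hcovN hσ₀ in
theorem differentiable_mutualInfo : Differentiable ℝ S.mutualInfo := by
  rw [funext (mutualInfo_eq hcovS hcovN hσ₀)]
  exact (S.entrywiseDifferentiable_receivedCov.det_re.log fun F =>
    (receivedCov_posDef hcovS hcovN hσ₀ F).det_re_pos.ne').sub
    (S.entrywiseDifferentiable_noiseCov.det_re.log fun F =>
    (noiseCov_posDef hcovN hσ₀ F).det_re_pos.ne')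

/-- The real bilinear form whose quadratic form is the transmit power of sensor `i`. -/
def powerForm (S : SensorNetwork L K M N) (i : Fin L) (X Y : Matrix (Fin (N i)) (Fin K) ℂ) : ℝ :=
  (trace (X * (S.covS + S.covN i) * Yᴴ)).re

include hcovS hcovN in
theorem powerForm_comm (i : Fin L) (X Y : Matrix (Fin (N i)) (Fin K) ℂ) :
    S.powerForm i X Y = S.powerForm i Y X := by
  have h : (X * (S.covS + S.covN i) * Yᴴ) = (Y * (S.covS + S.covN i) * Xᴴ)ᴴ := by
    rw [conjTranspose_mul, conjTranspose_mul, conjTranspose_conjTranspose,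
      (covS_add_covN_posDef hcovS hcovN i).1.eq, Matrix.mul_assoc]
  rw [powerForm, h, trace_conjTranspose]
  rfl

theorem powerForm_add_right (i : Fin L) (X Y Z : Matrix (Fin (N i)) (Fin K) ℂ) :
    S.powerForm i X (Y + Z) = S.powerForm i X Y + S.powerForm i X Z := by
  simp [powerForm, Matrix.mul_add]

theorem powerForm_smul_right (i : Fin L) (X Y : Matrix (Fin (N i)) (Fin K) ℂ) (t : ℝ) :
    S.powerForm i X (t • Y) = t * S.powerForm i X Y := by
  simp [powerForm]

include hcovS hcovN in
theorem power_add_smul (F Z : Precoders L K N) (t : ℝ) (i : Fin L) :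
    S.power (F + t • Z) i
      = S.power F i + t * (2 * S.powerForm i (F i) (Z i)) + t ^ 2 * S.power Z i := by
  change S.powerForm i (F i + t • Z i) (F i + t • Z i) = S.powerForm i (F i) (F i) + _
    + t ^ 2 * S.powerForm i (Z i) (Z i)
  have hc := powerForm_comm hcovS hcovN i
  rw [powerForm_add_right, powerForm_smul_right, hc _ (F i), hc _ (Z i), powerForm_add_right,
    powerForm_add_right, powerForm_smul_right, powerForm_smul_right, hc (Z i) (F i)]
  ring

include hcovS hcovN in
theorem fderiv_power (F Z : Precoders L K N) (i : Fin L) :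
    fderiv ℝ (fun F => S.power F i) F Z = 2 * S.powerForm i (F i) (Z i) := by
  have h := ((S.differentiable_power i F).hasFDerivAt.hasLineDerivAt Z)
  have h' : HasDerivAt (fun t : ℝ => S.power F i + t * (2 * S.powerForm i (F i) (Z i))
      + t ^ 2 * S.power Z i) (2 * S.powerForm i (F i) (Z i)) 0 := by
    have h1 := (((hasDerivAt_id (0 : ℝ)).mul_const (2 * S.powerForm i (F i) (Z i))).const_add
      (S.power F i)).add (((hasDerivAt_id (0 : ℝ)).pow 2).mul_const (S.power Z i))
    exact h1.congr_deriv (by simp)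
  rw [HasLineDerivAt, funext fun t => power_add_smul hcovS hcovN F Z t i] at h
  exact h.unique h'

/-- Multipliers for a linear functional that is nonpositive on all directions in which all power
constraints stay satisfied. -/
theorem exists_multipliers (hcovS : S.covS.PosDef) (hcovN : ∀ i, (S.covN i).PosSemidef)
    (hP : ∀ i, 0 < S.P i) {F : Precoders L K N} (hF : S.IsFeasible F)
    (ℓ : Precoders L K N →L[ℝ] ℝ)
    (hℓ : ∀ Z, (∀ᶠ t : ℝ in 𝓝[>] 0, S.IsFeasible (F + t • Z)) → ℓ Z ≤ 0) :
    ∃ mult : Fin L → ℝ, (∀ i, 0 ≤ mult i) ∧ (∀ i, mult i * (S.power F i - S.P i) = 0) ∧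
      ∀ Z, ℓ Z = ∑ i, mult i * (2 * S.powerForm i (F i) (Z i)) := by
  -- The constraints decouple: moving block i changes only the i-th power. A short move stays
  -- feasible if that constraint is slack or if its power strictly decreases to first order.
  have hdir : ∀ i (Y : Matrix (Fin (N i)) (Fin K) ℂ),
      S.power F i < S.P i ∨ S.powerForm i (F i) Y < 0 → ℓ (Pi.single i Y) ≤ 0 := by
    intro i Y h
    refine hℓ _ ?_
    have key : ∀ᶠ t : ℝ in 𝓝[>] 0, S.power (F + t • (Pi.single i Y : Precoders L K N)) i ≤ S.P i := by
      rcases h with h | h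
      · have hc : Continuous fun t : ℝ => S.power (F + t • (Pi.single i Y : Precoders L K N)) i :=
          (S.differentiable_power i).continuous.comp (by fun_prop)
        have := (hc.tendsto 0).eventually_lt_const (u := S.P i) (by simpa using h)
        exact (this.filter_mono nhdsWithin_le_nhds).mono fun t ht => ht.le
      · have hc : Continuous fun t : ℝ => 2 * S.powerForm i (F i) Y
            + t * S.power (Pi.single i Y : Precoders L K N) i := by fun_prop
        have := (hc.tendsto 0).eventually_lt_const (u := 0) (by rw [zero_mul]; linarith)
        filter_upwards [this.filter_mono nhdsWithin_le_nhds, self_mem_nhdsWithin] with t ht ht0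
        rw [power_add_smul hcovS hcovN, Pi.single_eq_same]
        have := mul_neg_of_pos_of_neg (Set.mem_Ioi.1 ht0) ht
        have := hF i
        linarith
    filter_upwards [key] with t ht j
    rcases eq_or_ne j i with rfl | hj
    · exact ht
    · have : S.power (F + t • (Pi.single i Y : Precoders L K N)) j = S.power F j := by
        simp [power, Pi.single_eq_of_ne hj]
      rw [this]
      exact hF j
  have hlin : ∀ i (Y Z : Matrix (Fin (N i)) (Fin K) ℂ) (t : ℝ),
      ℓ (Pi.single i (Y + t • Z)) = ℓ (Pi.single i Y) + t * ℓ (Pi.single i Z) := by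
    intro i Y Z t
    rw [Pi.single_add, map_add, Pi.single_smul, map_smul, smul_eq_mul]
  have hone : ∀ i, ∃ c : ℝ, 0 ≤ c ∧ c * (S.power F i - S.P i) = 0 ∧
      ∀ Y, ℓ (Pi.single i Y) = c * (2 * S.powerForm i (F i) Y) := by
    intro i
    -- Slack constraint: both Y and -Y are admissible, so ℓ vanishes on block i. The negative is
    -- written 0 + (-1) • Y to fit `hlin`.
    rcases (hF i).lt_or_eq with h | h
    · refine ⟨0, le_rfl, zero_mul _, fun Y => ?_⟩
      rw [zero_mul]
      have h1 := hdir i Y (.inl h)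
      have h2 := hdir i (0 + (-1 : ℝ) • Y) (.inl h)
      rw [hlin, Pi.single_zero, map_zero] at h2
      linarith
    · have hb : S.powerForm i (F i) (F i) = S.P i := h
      -- A direction tangent to an active constraint may leave the feasible set at second order.
      -- Tilting it by -ε F_i makes the power strictly decrease, as `P i > 0`; then ε tends to 0.
      have hneg : ∀ Y, S.powerForm i (F i) Y = 0 → ℓ (Pi.single i Y) ≤ 0 := by
        intro Y hY
        have hε : ∀ ε : ℝ, 0 < ε → ℓ (Pi.single i Y) ≤ ε * ℓ (Pi.single i (F i)) := by
          intro ε hε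
          have h1 := hdir i (Y + (-ε) • F i) (.inr ?_)
          · rw [hlin] at h1
            linarith
          · rw [powerForm_add_right, powerForm_smul_right, hY, hb]
            nlinarith [hP i]
        have hc : Continuous fun ε : ℝ => ε * ℓ (Pi.single i (F i)) := by fun_prop
        have ht := (hc.tendsto 0).mono_left (nhdsWithin_le_nhds (s := Set.Ioi 0))
        rw [zero_mul] at ht
        exact ge_of_tendsto ht (eventually_mem_nhdsWithin.mono fun ε h => hε ε h)
      have hzero : ∀ Y, S.powerForm i (F i) Y = 0 → ℓ (Pi.single i Y) = 0 := by
        intro Y hY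
        have h2 := hneg (0 + (-1 : ℝ) • Y) (by
          rw [zero_add, powerForm_smul_right, hY, mul_zero])
        rw [hlin, Pi.single_zero, map_zero] at h2
        linarith [hneg Y hY]
      have hpos : 0 ≤ ℓ (Pi.single i (F i)) := by
        have h1 := hdir i (0 + (-1 : ℝ) • F i) (.inr (by
          rw [zero_add, powerForm_smul_right, hb]; linarith [hP i]))
        rw [hlin, Pi.single_zero, map_zero] at h1
        linarith
      -- On block i, ℓ vanishes on the kernel of the power gradient, so it is a multiple of that
      -- gradient. Evaluation at F_i, where the form equals `P i`, gives the factor.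
      refine ⟨ℓ (Pi.single i (F i)) / (2 * S.P i), div_nonneg hpos (by linarith [hP i]),
        by rw [h, sub_self, mul_zero], fun Y => ?_⟩
      have hPi := (hP i).ne'
      have h1 := hzero (Y + (-(S.powerForm i (F i) Y / S.P i)) • F i) (by
        rw [powerForm_add_right, powerForm_smul_right, hb]; field_simp; ring)
      rw [hlin] at h1
      field_simp
      field_simp at h1
      linarith
  choose mult h0 h1 h2 using hone
  refine ⟨mult, h0, h1, fun Z => ?_⟩
  conv_lhs => rw [← Finset.univ_sum_single Z]
  rw [map_sum]
  exact Finset.sum_congr rfl fun i _ => h2 i (Z i)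

/-- A feasible point at which the augmented objective, with the matching weight and postcoder, is
maximal over the feasible set is a KKT point. -/
theorem isKKTPoint_of_augmentedInfo_le (hcovS : S.covS.PosDef)
    (hcovN : ∀ i, (S.covN i).PosSemidef) (hσ₀ : 0 < S.σ₀) (hP : ∀ i, 0 < S.P i)
    {F : Precoders L K N} (hF : S.IsFeasible F) {W : Matrix (Fin K) (Fin K) ℂ} (hW : W.PosDef)
    {G : Matrix (Fin M) (Fin K) ℂ} (htouch : S.augmentedInfo F W G = S.mutualInfo F)
    (hmax : ∀ F', S.IsFeasible F' → S.augmentedInfo F' W G ≤ S.augmentedInfo F W G) :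
    S.IsKKTPoint F := by
  have hMI := (differentiable_mutualInfo hcovS hcovN hσ₀ F).hasFDerivAt
  have hA := (S.differentiable_augmentedInfo W G F).hasFDerivAt
  -- The difference of `mutualInfo` and the minorant is nonnegative everywhere and zero at F, so its
  -- derivative vanishes there.
  have henv : fderiv ℝ S.mutualInfo F = fderiv ℝ (fun F => S.augmentedInfo F W G) F := by
    refine sub_eq_zero.1 (IsLocalMin.hasFDerivAt_eq_zero (Eventually.of_forall fun F' => ?_)
      (hMI.sub hA))
    have := augmentedInfo_le_mutualInfo hcovS hcovN hσ₀ F' hW G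
    simp only [Pi.sub_apply]
    linarith
  obtain ⟨mult, h0, h1, h2⟩ := exists_multipliers hcovS hcovN hP hF (fderiv ℝ S.mutualInfo F) (by
    intro Z hZ
    have hloc : IsLocalMaxOn (fun F => S.augmentedInfo F W G) {F' | S.IsFeasible F'} F :=
      eventually_mem_nhdsWithin.mono hmax
    rw [henv]
    exact hloc.hasFDerivWithinAt_nonpos hA.hasFDerivWithinAt
      (mem_posTangentConeAt_of_frequently_mem hZ.frequently))
  refine ⟨mult, ?_, hF, h0, h1⟩
  have hL := hMI.sub (HasFDerivAt.fun_sum (u := Finset.univ) fun i _ =>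
    (((S.differentiable_power i F).hasFDerivAt.sub_const (S.P i)).const_mul (mult i)))
  have hzero : fderiv ℝ S.mutualInfo F
      - ∑ i, mult i • fderiv ℝ (fun F => S.power F i) F = 0 := by
    ext Z
    simp [h2, fderiv_power hcovS hcovN]
  exact hL.congr_fderiv hzero

end Normed

end SensorNetwork

/-! ### Continuity of the updates and compactness of the feasible set -/

namespace Matrix

theorem trace_mul_conjTranspose_self_re {m n : Type*} [Fintype m] [Fintype n] (X : Matrix m n ℂ) :
    (X * Xᴴ).trace.re = ∑ a, ∑ b, ‖X a b‖ ^ 2 := by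
  simp [trace, mul_apply, Complex.sq_norm, Complex.normSq_apply]

theorem continuousAt_inv_of_isUnit {n : Type*} [Fintype n] [DecidableEq n] {A : Matrix n n ℂ}
    (hA : IsUnit A) : ContinuousAt Inv.inv A := by
  refine continuousAt_matrix_inv A ?_
  rw [Ring.inverse_eq_inv']
  exact continuousAt_inv₀ ((isUnit_iff_isUnit_det A).1 hA).ne_zero

end Matrix

namespace SensorNetwork

variable {L K M : ℕ} {N : Fin L → ℕ} (S : SensorNetwork L K M N)

theorem continuous_effChannel : Continuous S.effChannel := by
  unfold effChannel; fun_prop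

theorem continuous_noiseCov : Continuous S.noiseCov := by
  unfold noiseCov; fun_prop

theorem continuous_receivedCov : Continuous S.receivedCov := by
  have := S.continuous_effChannel
  have := S.continuous_noiseCov
  unfold receivedCov; fun_prop

theorem continuous_mseMatrix : Continuous fun p : Precoders L K N × Matrix (Fin M) (Fin K) ℂ =>
    S.mseMatrix p.1 p.2 := by
  have := S.continuous_effChannel
  have := S.continuous_noiseCov
  unfold mseMatrix; fun_prop

theorem continuous_power (i : Fin L) : Continuous fun F => S.power F i := by
  unfold power; fun_prop

variable {S} (hcovS : S.covS.PosDef) (hcovN : ∀ i, (S.covN i).PosSemidef) (hσ₀ : 0 < S.σ₀)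

include hcovS hcovN hσ₀ in
theorem continuous_mutualInfo : Continuous S.mutualInfo := by
  have h1 := S.continuous_receivedCov
  have h2 := S.continuous_noiseCov
  rw [funext (mutualInfo_eq hcovS hcovN hσ₀)]
  exact ((Complex.continuous_re.comp h1.matrix_det).log fun F =>
    (receivedCov_posDef hcovS hcovN hσ₀ F).det_re_pos.ne').sub
    ((Complex.continuous_re.comp h2.matrix_det).log fun F =>
    (noiseCov_posDef hcovN hσ₀ F).det_re_pos.ne')

include hcovS hcovN hσ₀ in
theorem continuous_updateG : Continuous S.updateG := by
  have h : Continuous fun F => (S.receivedCov F)⁻¹ := continuous_iff_continuousAt.2 fun F =>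
    ContinuousAt.comp (f := S.receivedCov)
      (continuousAt_inv_of_isUnit (receivedCov_posDef hcovS hcovN hσ₀ F).isUnit)
      S.continuous_receivedCov.continuousAt
  exact (h.matrix_mul S.continuous_effChannel).matrix_mul continuous_const

include hcovS hcovN hσ₀ in
theorem continuous_updateW : Continuous fun p : Precoders L K N × Matrix (Fin M) (Fin K) ℂ =>
    S.updateW p.1 p.2 :=
  continuous_iff_continuousAt.2 fun p =>
    ContinuousAt.comp (f := fun p : Precoders L K N × Matrix (Fin M) (Fin K) ℂ =>
      S.mseMatrix p.1 p.2)
      (continuousAt_inv_of_isUnit (mseMatrix_posDef hcovS hcovN hσ₀ p.1 p.2).isUnit)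
      S.continuous_mseMatrix.continuousAt

theorem continuousAt_augmentedInfo (F : Precoders L K N) {W : Matrix (Fin K) (Fin K) ℂ}
    (hW : W.PosDef) (G : Matrix (Fin M) (Fin K) ℂ) :
    ContinuousAt (fun p : Matrix (Fin K) (Fin K) ℂ × Matrix (Fin M) (Fin K) ℂ =>
      S.augmentedInfo F p.1 p.2) (W, G) := by
  have hd : Continuous fun p : Matrix (Fin K) (Fin K) ℂ × Matrix (Fin M) (Fin K) ℂ =>
      p.1.det.re := Complex.continuous_re.comp continuous_fst.matrix_det
  have hE : Continuous fun p : Matrix (Fin K) (Fin K) ℂ × Matrix (Fin M) (Fin K) ℂ =>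
      (trace (p.1 * S.mseMatrix F p.2)).re :=
    Complex.continuous_re.comp (continuous_fst.matrix_mul
      (S.continuous_mseMatrix.comp (continuous_const.prodMk continuous_snd))).matrix_trace
  exact (((hd.continuousAt.log hW.det_re_pos.ne').sub hE.continuousAt).add
    continuousAt_const).add continuousAt_const

theorem isClosed_isFeasible : IsClosed {F | S.IsFeasible F} := by
  simp only [IsFeasible, Set.ofPred_forall]
  exact isClosed_iInter fun i => isClosed_le (S.continuous_power i) continuous_const

-- With Y_i = F_i √(Σ_s + Σ_i) the power is the squared Frobenius norm of Y_i, so each entry of Y_i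
-- is at most √P_i in modulus. The feasible set is thus closed in a linear image of a compact
-- polydisc.
include hcovS hcovN in
theorem isCompact_isFeasible : IsCompact {F | S.IsFeasible F} := by
  have hQ := covS_add_covN_posDef hcovS hcovN
  have hR : ∀ i, CFC.sqrt (S.covS + S.covN i) * CFC.sqrt (S.covS + S.covN i)
    = S.covS + S.covN i := fun i => (hQ i).posSemidef.sqrt_mul_sqrt
  have hU : ∀ i, IsUnit (CFC.sqrt (S.covS + S.covN i)).det := by
    intro i
    have h := (isUnit_iff_isUnit_det _).1 (hQ i).isUnit
    rw [← hR, det_mul] at h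
    exact isUnit_of_mul_isUnit_left h
  have hK : IsCompact {Y : Precoders L K N |
      ∀ i a b, Y i a b ∈ Metric.closedBall (0 : ℂ) √(S.P i)} := by
    have h : IsCompact (Set.univ.pi fun i => Set.univ.pi fun _ : Fin (N i) =>
        Set.univ.pi fun _ : Fin K => Metric.closedBall (0 : ℂ) √(S.P i)) :=
      isCompact_univ_pi fun i => isCompact_univ_pi fun _ => isCompact_univ_pi fun _ =>
        isCompact_closedBall _ _
    have he : {Y : (i : Fin L) → Fin (N i) → Fin K → ℂ |
        ∀ i a b, Y i a b ∈ Metric.closedBall (0 : ℂ) √(S.P i)} = Set.univ.pi fun i =>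
          Set.univ.pi fun _ => Set.univ.pi fun _ => Metric.closedBall (0 : ℂ) √(S.P i) := by
      ext Y
      simp [Set.mem_pi]
    rw [← he] at h
    exact h
  have hc : Continuous fun Y : Precoders L K N =>
      (fun i => Y i * (CFC.sqrt (S.covS + S.covN i))⁻¹ : Precoders L K N) := by fun_prop
  refine (hK.image hc).of_isClosed_subset isClosed_isFeasible fun F hF => ?_
  refine ⟨fun i => F i * CFC.sqrt (S.covS + S.covN i), fun i a b => ?_, ?_⟩
  · have h : (F i * CFC.sqrt (S.covS + S.covN i) * (F i * CFC.sqrt (S.covS + S.covN i))ᴴ).trace.re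
        ≤ S.P i := by
      rw [conjTranspose_mul, conjTranspose_sqrt, Matrix.mul_assoc, ← Matrix.mul_assoc (CFC.sqrt _),
        hR, ← Matrix.mul_assoc]
      exact hF i
    rw [trace_mul_conjTranspose_self_re] at h
    rw [mem_closedBall_zero_iff]
    refine Real.le_sqrt_of_sq_le (le_trans ?_ h)
    refine le_trans ?_ (Finset.single_le_sum (fun a _ => Finset.sum_nonneg fun b _ => sq_nonneg _)
      (Finset.mem_univ a))
    exact Finset.single_le_sum (f := fun b => ‖(F i * CFC.sqrt (S.covS + S.covN i)) a b‖ ^ 2)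
      (fun b _ => sq_nonneg _) (Finset.mem_univ b)
  · ext1 i
    exact mul_nonsing_inv_cancel_right _ _ (hU i)

include hcovS hcovN in
theorem exists_solvesSOCP (hP : ∀ i, 0 < S.P i) {W : Matrix (Fin K) (Fin K) ℂ} (hW : W.PosDef)
    (G : Matrix (Fin M) (Fin K) ℂ) : ∃ F, S.SolvesSOCP W G (stackVec F) := by
  have hne : {F | S.IsFeasible F}.Nonempty := ⟨0, fun i => by simpa [power] using (hP i).le⟩
  have hE : Continuous fun F : Precoders L K N => (trace (W * S.mseMatrix F G)).re :=
    Complex.continuous_re.comp (continuous_const.matrix_mul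
      (S.continuous_mseMatrix.comp (continuous_id.prodMk continuous_const))).matrix_trace
  obtain ⟨F, hF, hmin⟩ := (isCompact_isFeasible hcovS hcovN).exists_isMinOn hne hE.continuousOn
  exact ⟨F, (solvesSOCP_iff hcovS hcovN hW G F).2 ⟨hF, fun F' hF' => hmin hF'⟩⟩

include hcovS hcovN hσ₀ in
theorem exists_isBatchModeBCA (hP : ∀ i, 0 < S.P i) {F₀ : Precoders L K N}
    (hF₀ : S.IsFeasible F₀) : ∃ F W G, S.IsBatchModeBCA F W G ∧ F 0 = F₀ := by
  choose next hnext using fun F : Precoders L K N => exists_solvesSOCP hcovS hcovN hP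
    (updateW_posDef hcovS hcovN hσ₀ F (S.updateG F)) (S.updateG F)
  let F : ℕ → Precoders L K N := fun j => next^[j] F₀
  refine ⟨F, fun j => S.updateW (F j) (S.updateG (F j)), fun j => S.updateG (F j),
    ⟨hF₀, fun j => ?_, fun _ => rfl, fun _ => rfl⟩, rfl⟩
  have h : F (j + 1) = next (F j) := Function.iterate_succ_apply' next j F₀
  rw [h]
  exact hnext (F j)

/-! ### Ascent along the iterates and their limit points -/

namespace IsBatchModeBCA

variable {F : ℕ → Precoders L K N} {W : ℕ → Matrix (Fin K) (Fin K) ℂ}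
  {G : ℕ → Matrix (Fin M) (Fin K) ℂ} (h : S.IsBatchModeBCA F W G)

include h

include hcovS hcovN hσ₀ in
theorem posDef (j : ℕ) : (W j).PosDef := by
  rw [h.stepW]
  exact updateW_posDef hcovS hcovN hσ₀ _ _

include hcovS hcovN hσ₀ in
theorem isFeasible (j : ℕ) : S.IsFeasible (F j) := by
  cases j with
  | zero => exact h.init
  | succ j =>
    exact ((solvesSOCP_iff hcovS hcovN (h.posDef hcovS hcovN hσ₀ j) _ _).1 (h.stepF j)).1

include hcovS hcovN hσ₀ in
theorem augmentedInfo_eq (j : ℕ) : S.augmentedInfo (F j) (W j) (G j) = S.mutualInfo (F j) := by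
  rw [h.stepW, h.stepG, augmentedInfo_update hcovS hcovN hσ₀]

-- The competitor F' is arbitrary: the current iterate yields ascent, and a fixed F' yields
-- optimality in the limit.
include hcovS hcovN hσ₀ in
theorem augmentedInfo_le (j : ℕ) {F' : Precoders L K N} (hF' : S.IsFeasible F') :
    S.augmentedInfo F' (W j) (G j) ≤ S.mutualInfo (F (j + 1)) := by
  have hW := h.posDef hcovS hcovN hσ₀ j
  refine le_trans ?_ (augmentedInfo_le_mutualInfo hcovS hcovN hσ₀ (F (j + 1)) hW (G j))
  have := ((solvesSOCP_iff hcovS hcovN hW _ _).1 (h.stepF j)).2 F' hF'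
  unfold augmentedInfo
  linarith

include hcovS hcovN hσ₀ in
theorem monotone_mutualInfo : Monotone fun j => S.mutualInfo (F j) :=
  monotone_nat_of_le_succ fun j => by
    rw [← h.augmentedInfo_eq hcovS hcovN hσ₀ j]
    exact h.augmentedInfo_le hcovS hcovN hσ₀ j (h.isFeasible hcovS hcovN hσ₀ j)

-- W_j and G_j are continuous functions of F_j, so convergence of the precoders along a subsequence
-- carries the other two blocks with it.
include hcovS hcovN hσ₀ in
theorem tendsto_updates {φ : ℕ → ℕ} {Fbar : Precoders L K N}
    (hφ : Tendsto (F ∘ φ) atTop (𝓝 Fbar)) :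
    Tendsto (W ∘ φ) atTop (𝓝 (S.updateW Fbar (S.updateG Fbar))) ∧
      Tendsto (G ∘ φ) atTop (𝓝 (S.updateG Fbar)) := by
  have hG := continuous_updateG hcovS hcovN hσ₀
  have hW := (continuous_updateW hcovS hcovN hσ₀).comp (continuous_id.prodMk hG)
  have h1 : W ∘ φ = (fun F => S.updateW F (S.updateG F)) ∘ (F ∘ φ) := by
    ext1 k
    simp only [Function.comp_apply]
    rw [h.stepW, h.stepG]
  have h2 : G ∘ φ = S.updateG ∘ (F ∘ φ) := funext fun k => h.stepG (φ k)
  rw [h1, h2]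
  exact ⟨(hW.tendsto Fbar).comp hφ, (hG.tendsto Fbar).comp hφ⟩

include hcovS hcovN hσ₀ in
theorem isKKTPoint (hP : ∀ i, 0 < S.P i) {Fbar : Precoders L K N} (hlim : IsLimitPoint F Fbar) :
    S.IsKKTPoint Fbar := by
  obtain ⟨φ, hφ, hF⟩ := hlim
  obtain ⟨hW, hG⟩ := h.tendsto_updates hcovS hcovN hσ₀ hF
  have hWbar := updateW_posDef hcovS hcovN hσ₀ Fbar (S.updateG Fbar)
  have htouch := augmentedInfo_update hcovS hcovN hσ₀ Fbar
  -- By monotonicity, the value at F̄ bounds the whole sequence, including the indices φ k + 1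
  -- outside the subsequence.
  have hbound : ∀ j, S.mutualInfo (F j) ≤ S.mutualInfo Fbar := fun j =>
    ge_of_tendsto (((continuous_mutualInfo hcovS hcovN hσ₀).tendsto Fbar).comp hF)
      ((hφ.tendsto_atTop.eventually_ge_atTop j).mono fun k hk =>
        h.monotone_mutualInfo hcovS hcovN hσ₀ hk)
  refine isKKTPoint_of_augmentedInfo_le hcovS hcovN hσ₀ hP
    (isClosed_isFeasible.mem_of_tendsto hF
      (Eventually.of_forall fun k => h.isFeasible hcovS hcovN hσ₀ (φ k))) hWbar htouch ?_
  intro F' hF'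
  rw [htouch]
  -- Only W and G pass to the limit here; F' is fixed and F_{φ k + 1} enters through its value
  -- alone.
  exact le_of_tendsto ((continuousAt_augmentedInfo F' hWbar _).tendsto.comp (hW.prodMk_nhds hG))
    (Eventually.of_forall fun k =>
      (h.augmentedInfo_le hcovS hcovN hσ₀ (φ k) hF').trans (hbound _))

include hcovS hcovN hσ₀ in
theorem exists_isLimitPoint : ∃ Fbar Wbar Gbar,
    IsLimitPoint (fun j => (F j, W j, G j)) (Fbar, Wbar, Gbar) := by
  have : FirstCountableTopology (Precoders L K N) :=
    inferInstanceAs (FirstCountableTopology ((i : Fin L) → Fin (N i) → Fin K → ℂ))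
  obtain ⟨Fbar, -, φ, hφ, hF⟩ := (isCompact_isFeasible hcovS hcovN).tendsto_subseq
    (h.isFeasible hcovS hcovN hσ₀)
  obtain ⟨hW, hG⟩ := h.tendsto_updates hcovS hcovN hσ₀ hF
  exact ⟨Fbar, _, _, φ, hφ, hF.prodMk_nhds (hW.prodMk_nhds hG)⟩

end IsBatchModeBCA

end SensorNetwork

theorem mainTheorem1 {L K M : ℕ} {N : Fin L → ℕ} (S : SensorNetwork L K M N)
    (hcovS : S.covS.PosDef) (hcovN : ∀ i, (S.covN i).PosSemidef)
    (hσ₀ : 0 < S.σ₀) (hP : ∀ i, 0 < S.P i) :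
    (∀ F₀ : Precoders L K N, S.IsFeasible F₀ →
      ∃ F W G, S.IsBatchModeBCA F W G ∧ F 0 = F₀) ∧
    ∀ (F : ℕ → Precoders L K N) (W : ℕ → Matrix (Fin K) (Fin K) ℂ)
      (G : ℕ → Matrix (Fin M) (Fin K) ℂ), S.IsBatchModeBCA F W G →
      Monotone (fun j => S.mutualInfo (F j)) ∧
      Monotone (fun j => S.augmentedInfo (F j) (W j) (G j)) ∧
      (∃ Fbar Wbar Gbar, IsLimitPoint (fun j => (F j, W j, G j)) (Fbar, Wbar, Gbar)) ∧
      (∀ Fbar Wbar Gbar, IsLimitPoint (fun j => (F j, W j, G j)) (Fbar, Wbar, Gbar) →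
        S.IsKKTPoint Fbar) ∧
      (∀ Fbar, IsLimitPoint F Fbar → S.IsKKTPoint Fbar) := by
  refine ⟨fun F₀ hF₀ => SensorNetwork.exists_isBatchModeBCA hcovS hcovN hσ₀ hP hF₀,
    fun F W G h => ?_⟩
  have hmono := h.monotone_mutualInfo hcovS hcovN hσ₀
  refine ⟨hmono, ?_, h.exists_isLimitPoint hcovS hcovN hσ₀, ?_,
    fun Fbar hlim => h.isKKTPoint hcovS hcovN hσ₀ hP hlim⟩
  · simpa only [h.augmentedInfo_eq hcovS hcovN hσ₀] using hmono
  · rintro Fbar Wbar Gbar ⟨φ, hφ, hlim⟩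
    exact h.isKKTPoint hcovS hcovN hσ₀ hP ⟨φ, hφ, (continuous_fst.tendsto _).comp hlim⟩
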